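/- Let $\Delta=\{z\in\mathbb C:|z|<1\}$ and let $b\Delta$ be the unit circle. For a continuous function $\varphi\colon b\Delta\to\mathbb C$ with no zeros, let $W(\varphi)\in\mathbb Z$ denote its winding number around $0$, that is, $2\pi W(\varphi)$ is the change of argument of $\varphi(z)$ as $z$ runs once around $b\Delta$ in the positive direction. Let $f\colon b\Delta\to\mathbb C$ be continuous, and assume that $$W\bigl(P\cdot(f+c)+1\bigr)\ge 0$$ for every constant $c\in\mathbb C$ and every polynomial $P\in\mathbb C[z]$ such that $P(z)\,(f(z)+c)+1\neq 0$ for all $z\in b\Delta$. Then $f$ extends holomorphically through $\Delta$: there is a continuous function $F\colon\overline\Delta\to\mathbb C$ that is holomorphic on $\Delta$ and satisfies $F=f$ on $b\Delta$. -/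

import Mathlib

open Polynomial

/-- `n` is the winding number of `φ : bΔ → ℂ` around `0`: there is a continuous choice `θ t` of the
argument of `φ (e ^ (i t))` whose change over one positive turn of the unit circle is `2 π n`. -/
def IsWindingNumber (φ : Circle → ℂ) (n : ℤ) : Prop :=
  ∃ θ : ℝ → ℝ, Continuous θ ∧
    (∀ t : ℝ, φ (Circle.exp t) = (‖φ (Circle.exp t)‖ : ℂ) * (Circle.exp (θ t) : ℂ)) ∧
    θ (2 * Real.pi) - θ 0 = 2 * Real.pi * n

theorem IsWindingNumber.unique {φ : Circle → ℂ} (h0 : ∀ z, φ z ≠ 0) {m n : ℤ}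
    (hm : IsWindingNumber φ m) (hn : IsWindingNumber φ n) : m = n := by
  obtain ⟨θ, hθ, hφ, hd⟩ := hm
  obtain ⟨η, hη, hψ, he⟩ := hn
  have key : ∀ t, Circle.exp (θ t) = Circle.exp (η t) := by
    intro t
    have h1 : (‖φ (Circle.exp t)‖ : ℂ) ≠ 0 := by
      simpa using h0 (Circle.exp t)
    exact Circle.ext (mul_left_cancel₀ h1 ((hφ t).symm.trans (hψ t)))
  have h2 : θ = fun t => η t + (θ 0 - η 0) := by
    refine Circle.isCoveringMap_exp.eq_of_comp_eq hθ (by fun_prop) ?_ 0 (by ring)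
    funext t
    simp [Circle.exp_add, Circle.exp_sub, key]
  have h3 := congrFun h2 (2 * Real.pi)
  have h4 : 2 * Real.pi * (m : ℝ) = 2 * Real.pi * n := by linarith
  exact_mod_cast mul_left_cancel₀ (by positivity) h4

theorem exists_isWindingNumber {φ : Circle → ℂ} (hc : Continuous φ) (h0 : ∀ z, φ z ≠ 0) :
    ∃ n : ℤ, IsWindingNumber φ n := by
  have hc' : Continuous fun t : ℝ => φ (Circle.exp t) := by fun_prop
  let u : C(ℝ, Circle) :=
    ⟨fun t => ⟨φ (Circle.exp t) / (‖φ (Circle.exp t)‖ : ℂ), by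
      have := h0 (Circle.exp t)
      refine mem_sphere_zero_iff_norm.2 ?_
      simp [this]⟩, by
      refine Continuous.subtype_mk (hc'.div (by fun_prop) fun t => ?_) _
      simpa using h0 (Circle.exp t)⟩
  obtain ⟨x, hx⟩ := Circle.exp_surjective (u 0)
  obtain ⟨Γ, ⟨-, hΓ⟩, -⟩ :=
    Circle.isCoveringMap_exp.existsUnique_continuousMap_lifts u (a₀ := 0) (e₀ := x) hx
  have hu : ∀ t, Circle.exp (Γ t) = u t := fun t => congrFun hΓ t
  have h1 : Circle.exp (Γ (2 * Real.pi)) = Circle.exp (Γ 0) := by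
    rw [hu, hu]
    apply Circle.ext
    change φ _ / (‖φ _‖ : ℂ) = φ _ / (‖φ _‖ : ℂ)
    rw [Circle.exp_two_pi, Circle.exp_zero]
  obtain ⟨n, hn⟩ := Circle.exp_eq_exp.1 h1
  refine ⟨n, Γ, Γ.continuous, fun t => ?_, by rw [hn]; ring⟩
  have h2 : (‖φ (Circle.exp t)‖ : ℂ) ≠ 0 := by
    simpa using h0 (Circle.exp t)
  rw [hu]
  exact (mul_div_cancel₀ _ h2).symm

open Classical in
/-- The winding number `W(φ)` around `0` of a function `φ : bΔ → ℂ`. It exists and is unique if `φ`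
is continuous without zeros; it takes the value `0` where there is no winding number. -/
noncomputable def windingNumber (φ : Circle → ℂ) : ℤ :=
  if h : ∃ n : ℤ, IsWindingNumber φ n then h.choose else 0

theorem IsWindingNumber.windingNumber_eq {φ : Circle → ℂ} (h0 : ∀ z, φ z ≠ 0) {n : ℤ}
    (hn : IsWindingNumber φ n) : windingNumber φ = n := by
  have h : ∃ n : ℤ, IsWindingNumber φ n := ⟨n, hn⟩
  rw [windingNumber, dif_pos h]
  exact h.choose_spec.unique h0 hn

theorem isWindingNumber_windingNumber {φ : Circle → ℂ} (hc : Continuous φ) (h0 : ∀ z, φ z ≠ 0) :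
    IsWindingNumber φ (windingNumber φ) := by
  obtain ⟨n, hn⟩ := exists_isWindingNumber hc h0
  rwa [hn.windingNumber_eq h0]

/-- `f : bΔ → ℂ` extends holomorphically through the open unit disc `Δ`: it is the boundary function
of a function that is continuous on the closed disc and holomorphic on `Δ`. -/
def ExtendsHolomorphically (f : Circle → ℂ) : Prop :=
  ∃ F : ℂ → ℂ, ContinuousOn F (Metric.closedBall 0 1) ∧
    DifferentiableOn ℂ F (Metric.ball 0 1) ∧ ∀ z : Circle, F z = f z

/-! On the circle, z^(N+1) f is uniformly close to a polynomial R. Let s be the norm of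
multiplication by R modulo X^(N+1) on polynomials of degree at most N, with the ℓ² norm on
coefficients. Carathéodory–Fejér (`exists_unimodular_interpolant`) gives R u = v + X^(N+1) r with
deg v ≤ N, u zero-free on the closed disc, and |v| = s|u| on the circle. Hence f is close to r/u +
z^(-N-1) v/u: a holomorphic part plus a remainder of constant modulus s.

If s is at most the tolerance, f is close to r/u, hence to a polynomial; if this happens for every
tolerance, f extends.

Otherwise take c so large that r + cu is zero-free on the closed disc, and a polynomial P close to
-u/(r + cu). Then P(f + c) + 1 is close to -z^(-N-1) v/(r + cu), and Rouché gives it winding number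
(zeros of v in the disc) - (N+1) ≤ -1, against the hypothesis (`exists_windingNumber_neg`).

The pair (u, v) comes from a vector attaining the norm s: extremality forces |v| = s|u|, and the
zeros of u in the closed disc can be divided out of both (`IsUnimodularPair.exists_of_isRoot`). -/

/-! ### Winding numbers, Rouché and the argument principle -/

theorem IsWindingNumber.mul {φ ψ : Circle → ℂ} {m n : ℤ} (hφ : IsWindingNumber φ m)
    (hψ : IsWindingNumber ψ n) : IsWindingNumber (fun z => φ z * ψ z) (m + n) := by
  obtain ⟨θ, hθ, h1, h2⟩ := hφ
  obtain ⟨η, hη, h3, h4⟩ := hψ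
  refine ⟨fun t => θ t + η t, hθ.add hη, fun t => ?_, ?_⟩
  · rw [Circle.exp_add, norm_mul, Circle.coe_mul, Complex.ofReal_mul]
    linear_combination ψ (Circle.exp t) * h1 t
      + (‖φ (Circle.exp t)‖ : ℂ) * (Circle.exp (θ t) : ℂ) * h3 t
  · push_cast
    linarith

/-- The principal argument is continuous there and, depending only on the point, returns to its
initial value. -/
theorem isWindingNumber_zero_of_mem_slitPlane {φ : Circle → ℂ} (hc : Continuous φ)
    (h : ∀ z, φ z ∈ Complex.slitPlane) : IsWindingNumber φ 0 := by
  refine ⟨fun t => Complex.arg (φ (Circle.exp t)), ?_, fun t => ?_, ?_⟩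
  · rw [continuous_iff_continuousAt]
    intro t
    exact (Complex.continuousAt_arg (h _)).comp (f := fun t => φ (Circle.exp t))
      (by fun_prop)
  · rw [Circle.coe_exp, Complex.norm_mul_exp_arg_mul_I]
  · simp

theorem isWindingNumber_const {c : ℂ} : IsWindingNumber (fun _ => c) 0 := by
  refine ⟨fun _ => Complex.arg c, continuous_const, fun t => ?_, ?_⟩
  · rw [Circle.coe_exp, Complex.norm_mul_exp_arg_mul_I]
  · simp

theorem isWindingNumber_coe : IsWindingNumber (fun z : Circle => (z : ℂ)) 1 :=
  ⟨fun t => t, continuous_id, fun t => by simp, by simp⟩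

/-- Rouché's theorem for winding numbers. -/
theorem IsWindingNumber.of_norm_sub_lt {φ ψ : Circle → ℂ} (hφ : Continuous φ) (hψ : Continuous ψ)
    (h : ∀ z, ‖ψ z - φ z‖ < ‖φ z‖) {n : ℤ} (hn : IsWindingNumber φ n) : IsWindingNumber ψ n := by
  have h0 : ∀ z, φ z ≠ 0 := fun z hz => by
    have := h z
    rw [hz, norm_zero] at this
    exact absurd this (not_lt.2 (norm_nonneg _))
  have h1 : IsWindingNumber (fun z => ψ z / φ z) 0 := by
    refine isWindingNumber_zero_of_mem_slitPlane (hψ.div hφ h0) fun z => ?_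
    have h2 : ψ z / φ z ∈ Metric.ball (1 : ℂ) 1 := by
      rw [mem_ball_iff_norm, div_sub_one (h0 z), norm_div, div_lt_one (norm_pos_iff.2 (h0 z))]
      exact h z
    exact Complex.ball_one_subset_slitPlane h2
  have h3 := hn.mul h1
  rw [add_zero] at h3
  convert h3 using 2 with z
  field_simp [h0 z]

theorem isWindingNumber_sub_of_one_lt {a : ℂ} (ha : 1 < ‖a‖) :
    IsWindingNumber (fun z : Circle => (z : ℂ) - a) 0 :=
  IsWindingNumber.of_norm_sub_lt (φ := fun _ => -a) (by fun_prop) (by fun_prop)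
    (fun z => by simpa using (Circle.norm_coe z).trans_lt ha) isWindingNumber_const

theorem isWindingNumber_sub_of_lt_one {a : ℂ} (ha : ‖a‖ < 1) :
    IsWindingNumber (fun z : Circle => (z : ℂ) - a) 1 :=
  IsWindingNumber.of_norm_sub_lt (φ := fun z : Circle => (z : ℂ)) (by fun_prop) (by fun_prop)
    (fun z => by simpa using ha.trans_eq (Circle.norm_coe z).symm) isWindingNumber_coe

theorem isWindingNumber_multiset_prod (s : Multiset ℂ) (hs : ∀ a ∈ s, ‖a‖ ≠ 1) :
    IsWindingNumber (fun z : Circle => (s.map fun a => (z : ℂ) - a).prod) (s.countP fun a => ‖a‖ < 1) := by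
  induction s using Multiset.induction_on with
  | empty => simpa using isWindingNumber_const (c := 1)
  | cons a s ih =>
    have h1 := ih fun b hb => hs b (Multiset.mem_cons_of_mem hb)
    simp only [Multiset.map_cons, Multiset.prod_cons]
    rcases lt_or_gt_of_ne (hs a (Multiset.mem_cons_self a s)) with h | h
    · rw [Multiset.countP_cons_of_pos (p := fun a : ℂ => ‖a‖ < 1) _ h]
      have := (isWindingNumber_sub_of_lt_one h).mul h1
      rwa [add_comm] at this
    · rw [Multiset.countP_cons_of_neg (p := fun a : ℂ => ‖a‖ < 1) _ (not_lt.2 h.le)]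
      simpa using (isWindingNumber_sub_of_one_lt h).mul h1

/-- The argument principle for polynomials on the unit disc. -/
theorem isWindingNumber_eval {p : ℂ[X]} (hp : ∀ z : Circle, p.eval (z : ℂ) ≠ 0) :
    IsWindingNumber (fun z : Circle => p.eval (z : ℂ)) (p.roots.countP fun a => ‖a‖ < 1) := by
  have h1 := (isWindingNumber_const (c := p.leadingCoeff)).mul
    (isWindingNumber_multiset_prod p.roots fun a ha h => hp ⟨a, mem_sphere_zero_iff_norm.2 h⟩
      (isRoot_of_mem_roots ha))
  rw [zero_add] at h1
  convert h1 using 2 with z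
  exact (IsAlgClosed.splits p).eval_eq_prod_roots _

theorem isWindingNumber_eval_zero {p : ℂ[X]} (hp : ∀ z : ℂ, ‖z‖ ≤ 1 → p.eval z ≠ 0) :
    IsWindingNumber (fun z : Circle => p.eval (z : ℂ)) 0 := by
  have h1 := isWindingNumber_eval (p := p) fun z => hp z z.norm_coe.le
  rwa [Multiset.countP_eq_zero.2 fun a ha h => hp a h.le (isRoot_of_mem_roots ha)] at h1

theorem isWindingNumber_pow (n : ℕ) : IsWindingNumber (fun z : Circle => (z : ℂ) ^ n) n := by
  induction n with
  | zero => simpa using isWindingNumber_const (c := 1)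
  | succ n ih => simpa [pow_succ] using ih.mul isWindingNumber_coe

/-! ### Conjugate-reversed polynomials and moduli on the circle -/

open scoped ComplexConjugate in
/-- The polynomial `z ^ N * conj (p (1 / conj z))`, for `p` of degree at most `N`. -/
noncomputable def conjReflect (N : ℕ) (p : ℂ[X]) : ℂ[X] := reflect N (p.map (starRingEnd ℂ))

section conjReflect

open scoped ComplexConjugate

variable {N : ℕ} {p q : ℂ[X]}

theorem coeff_conjReflect {i : ℕ} (hi : i ≤ N) :
    (conjReflect N p).coeff i = conj (p.coeff (N - i)) := by
  rw [conjReflect, coeff_reflect, revAt_le hi, coeff_map]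

theorem conjReflect_sub : conjReflect N (p - q) = conjReflect N p - conjReflect N q := by
  rw [conjReflect, Polynomial.map_sub, reflect_sub, conjReflect, conjReflect]

theorem natDegree_conjReflect_le (hp : p.natDegree ≤ N) : (conjReflect N p).natDegree ≤ N :=
  natDegree_reflect_le.trans (max_le le_rfl (natDegree_map_le.trans hp))

theorem conjReflect_conjReflect (hp : p.natDegree ≤ N) :
    conjReflect N (conjReflect N p) = p := by
  ext i
  rcases le_or_gt i N with hi | hi
  · rw [coeff_conjReflect hi, coeff_conjReflect (Nat.sub_le _ _), Nat.sub_sub_self hi,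
      Complex.conj_conj]
  · rw [coeff_eq_zero_of_natDegree_lt (hp.trans_lt hi), coeff_eq_zero_of_natDegree_lt
      ((natDegree_conjReflect_le (natDegree_conjReflect_le hp)).trans_lt hi)]

theorem conjReflect_mul {M : ℕ} (hp : p.natDegree ≤ M) (hq : q.natDegree ≤ N) :
    conjReflect (M + N) (p * q) = conjReflect M p * conjReflect N q := by
  rw [conjReflect, Polynomial.map_mul,
    reflect_mul _ _ (natDegree_map_le.trans hp) (natDegree_map_le.trans hq), conjReflect,
    conjReflect]

theorem conjReflect_one_X_sub_C (a : ℂ) : conjReflect 1 (X - C a) = 1 - C (conj a) * X := by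
  simp [conjReflect, reflect_sub, reflect_C, reflect_one_X]

theorem conjReflect_one_one_sub_C_mul_X (a : ℂ) :
    conjReflect 1 (1 - C (conj a) * X) = X - C a := by
  rw [← conjReflect_one_X_sub_C, conjReflect_conjReflect (natDegree_X_sub_C_le a)]

theorem natDegree_one_sub_C_mul_X_le (a : ℂ) : (1 - C a * X : ℂ[X]).natDegree ≤ 1 := by
  compute_degree

theorem conjReflect_X_sub_C_mul (a : ℂ) (hq : q.natDegree ≤ N) :
    conjReflect (N + 1) ((X - C a) * q) = (1 - C (conj a) * X) * conjReflect N q := by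
  rw [add_comm, conjReflect_mul (natDegree_X_sub_C_le a) hq, conjReflect_one_X_sub_C]

theorem conjReflect_one_sub_C_mul_X_mul (a : ℂ) (hq : q.natDegree ≤ N) :
    conjReflect (N + 1) ((1 - C (conj a) * X) * q) = (X - C a) * conjReflect N q := by
  rw [add_comm, conjReflect_mul (natDegree_one_sub_C_mul_X_le _) hq,
    conjReflect_one_one_sub_C_mul_X]

theorem conjReflect_succ (hq : q.natDegree ≤ N) :
    conjReflect (N + 1) q = X * conjReflect N q := by
  have h := conjReflect_mul (p := 1) (M := 1) (by simp) hq
  rw [one_mul, add_comm] at h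
  rw [h]
  simp [conjReflect]

theorem conjReflect_C_mul_X_pow (c : ℂ) : conjReflect N (C c * X ^ N) = C (conj c) := by
  simp [conjReflect, reflect_C_mul, reflect_monomial, revAt_le le_rfl]

/-- On the circle conj z = 1/z. Consequently `conjReflect N p * p` takes the value z^N |p|², so it
encodes the modulus of p on the circle. -/
theorem eval_conjReflect (hp : p.natDegree ≤ N) {z : ℂ} (hz : ‖z‖ = 1) :
    (conjReflect N p).eval z = z ^ N * conj (p.eval z) := by
  have hz1 : z * conj z = 1 := by
    rw [Complex.mul_conj, Complex.normSq_eq_norm_sq, hz]; norm_num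
  rw [eval_eq_sum_range' (Nat.lt_succ_of_le (natDegree_conjReflect_le hp)),
    eval_eq_sum_range' (Nat.lt_succ_of_le hp), map_sum, Finset.mul_sum,
    ← Finset.sum_range_reflect]
  refine Finset.sum_congr rfl fun i hi => ?_
  have hi' : i ≤ N := Nat.lt_succ_iff.1 (Finset.mem_range.1 hi)
  rw [Nat.succ_sub_one, coeff_conjReflect (Nat.sub_le _ _), Nat.sub_sub_self hi', map_mul,
    map_pow]
  have h2 : z ^ N = z ^ (N - i) * z ^ i := by rw [← pow_add, Nat.sub_add_cancel hi']
  have h3 : z ^ i * conj z ^ i = 1 := by rw [← mul_pow, hz1, one_pow]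
  rw [h2]
  linear_combination (-conj (p.coeff i) * z ^ (N - i)) * h3

/-- The `ℓ²` inner product of the first `N + 1` coefficients. -/
noncomputable def coeffInner (N : ℕ) (p q : ℂ[X]) : ℂ :=
  ∑ i ∈ Finset.range (N + 1), conj (p.coeff i) * q.coeff i

theorem coeff_conjReflect_mul_self :
    (conjReflect N p * q).coeff N = coeffInner N p q := by
  rw [coeff_mul, Finset.Nat.sum_antidiagonal_eq_sum_range_succ
    (fun i j => (conjReflect N p).coeff i * q.coeff j), coeffInner, ← Finset.sum_range_reflect]
  refine Finset.sum_congr rfl fun i hi => ?_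
  have hi' : i ≤ N := Nat.lt_succ_iff.1 (Finset.mem_range.1 hi)
  rw [Nat.succ_sub_one, coeff_conjReflect (Nat.sub_le _ _), Nat.sub_sub_self hi']

theorem coeff_conjReflect_mul_sub {k : ℕ} (hk : k ≤ N) :
    (conjReflect N p * q).coeff (N - k) = coeffInner N p (X ^ k * q) := by
  rw [← coeff_conjReflect_mul_self, mul_left_comm, coeff_X_pow_mul', if_pos hk]

theorem coeff_conjReflect_mul_self_symm (hp : p.natDegree ≤ N) {k : ℕ} (hk : k ≤ 2 * N) :
    (conjReflect N p * p).coeff k = conj ((conjReflect N p * p).coeff (2 * N - k)) := by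
  rw [← coeff_conjReflect hk, two_mul, conjReflect_mul (natDegree_conjReflect_le hp) hp,
    conjReflect_conjReflect hp, mul_comm]

end conjReflect

/-! ### Norm-attaining vectors of truncated multiplication -/

section extremal

open scoped ComplexConjugate InnerProductSpace

/-- A maximiser x of ‖L x‖ on the compact unit sphere is an eigenvector of L*L for ‖L‖²: expanding
‖L*L x - ‖L‖² x‖² bounds it by ‖L‖⁴ - 2‖L‖⁴ + ‖L‖⁴ = 0. -/
theorem ContinuousLinearMap.exists_inner_map_eq_norm_sq_mul {E : Type*} [NormedAddCommGroup E]
    [InnerProductSpace ℂ E] [FiniteDimensional ℂ E] [Nontrivial E] (L : E →L[ℂ] E) :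
    ∃ x : E, x ≠ 0 ∧ ∀ y, ⟪L x, L y⟫_ℂ = (‖L‖ : ℂ) ^ 2 * ⟪x, y⟫_ℂ := by
  have : CompleteSpace E := FiniteDimensional.complete ℂ E
  have : ProperSpace E := FiniteDimensional.proper ℂ E
  obtain ⟨x, hx, hmax⟩ := (isCompact_sphere (0 : E) 1).exists_isMaxOn
    (by
      obtain ⟨e, he⟩ := exists_norm_eq E (zero_le_one (α := ℝ))
      exact ⟨e, by simpa using he⟩)
    (L.continuous.norm.continuousOn)
  have hx1 : ‖x‖ = 1 := by simpa using hx
  have hL : ‖L‖ = ‖L x‖ := by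
    refine le_antisymm (L.opNorm_le_bound (norm_nonneg _) fun y => ?_) (L.unit_le_opNorm x hx1.le)
    rcases eq_or_ne y 0 with rfl | hy
    · simp
    · have hy' : ‖y‖ ≠ 0 := norm_ne_zero_iff.2 hy
      have h1 := hmax (show (((‖y‖⁻¹ : ℝ) : ℂ) • y) ∈ Metric.sphere (0 : E) 1 by
        simp [norm_smul, hy'])
      simp only [Set.mem_ofPred_eq, map_smul, norm_smul, Complex.norm_real, norm_inv, norm_norm]
        at h1
      rwa [inv_mul_le_iff₀ (by positivity), mul_comm] at h1
  refine ⟨x, fun h => by simp [h] at hx1, fun y => ?_⟩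
  have h2 : L.adjoint (L x) = ((‖L‖ : ℂ) ^ 2) • x := by
    rw [← sub_eq_zero, ← norm_eq_zero, ← sq_eq_zero_iff]
    refine le_antisymm ?_ (sq_nonneg _)
    have h3 := norm_sub_sq (𝕜 := ℂ) (L.adjoint (L x)) (((‖L‖ : ℂ) ^ 2) • x)
    have h4 : RCLike.re ⟪L.adjoint (L x), ((‖L‖ : ℂ) ^ 2) • x⟫_ℂ = ‖L‖ ^ 4 := by
      rw [inner_smul_right, ContinuousLinearMap.adjoint_inner_left, inner_self_eq_norm_sq_to_K,
        ← hL]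
      change RCLike.re ((‖L‖ : ℂ) ^ 2 * (‖L‖ : ℂ) ^ 2) = ‖L‖ ^ 4
      rw [← pow_add, ← Complex.ofReal_pow]
      exact Complex.ofReal_re _
    have h5 : ‖((‖L‖ : ℂ) ^ 2) • x‖ = ‖L‖ ^ 2 := by simp [norm_smul, hx1]
    have h6 : ‖L.adjoint (L x)‖ ≤ ‖L‖ ^ 2 := by
      have := L.adjoint.le_opNorm (L x)
      rwa [← hL, LinearIsometryEquiv.norm_map, ← sq] at this
    rw [h3, h4, h5]
    have := pow_le_pow_left₀ (norm_nonneg _) h6 2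
    nlinarith
  rw [← ContinuousLinearMap.adjoint_inner_left, h2, inner_smul_left]
  simp

/-- The polynomial of degree at most `N` with given coefficients. -/
noncomputable def polyOfCoeffs (N : ℕ) (x : EuclideanSpace ℂ (Fin (N + 1))) : ℂ[X] :=
  ∑ i : Fin (N + 1), monomial (i : ℕ) (x i)

/-- The vector of the first `N + 1` coefficients. -/
noncomputable def coeffVec (N : ℕ) (p : ℂ[X]) : EuclideanSpace ℂ (Fin (N + 1)) :=
  WithLp.toLp 2 fun i => p.coeff i

theorem inner_coeffVec (N : ℕ) (p q : ℂ[X]) :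
    ⟪coeffVec N p, coeffVec N q⟫_ℂ = coeffInner N p q := by
  rw [PiLp.inner_apply, coeffInner, Finset.sum_range]
  refine Finset.sum_congr rfl fun i _ => ?_
  simp [coeffVec, mul_comm]

theorem norm_coeffVec_sq (N : ℕ) (p : ℂ[X]) :
    ‖coeffVec N p‖ ^ 2 = (coeffInner N p p).re := by
  rw [← inner_coeffVec, inner_self_eq_norm_sq_to_K]
  norm_cast

theorem coeffVec_polyOfCoeffs (N : ℕ) (x : EuclideanSpace ℂ (Fin (N + 1))) :
    coeffVec N (polyOfCoeffs N x) = x := by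
  ext i
  simp [coeffVec, polyOfCoeffs, coeff_monomial, Fin.val_inj]

theorem natDegree_polyOfCoeffs_le (N : ℕ) (x : EuclideanSpace ℂ (Fin (N + 1))) :
    (polyOfCoeffs N x).natDegree ≤ N :=
  natDegree_sum_le_of_forall_le _ _ fun i _ =>
    (natDegree_monomial_le _).trans (Nat.lt_succ_iff.1 i.2)

theorem coeffVec_eq_iff {N : ℕ} {p q : ℂ[X]} :
    coeffVec N p = coeffVec N q ↔ X ^ (N + 1) ∣ p - q := by
  rw [X_pow_dvd_iff]
  constructor
  · intro h d hd
    have := congrArg (fun x => x ⟨d, hd⟩) h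
    simpa [coeffVec, sub_eq_zero] using this
  · intro h
    ext i
    simpa [coeffVec, sub_eq_zero] using h i i.2

/-- Multiplication by `R` on polynomials of degree at most `N`, modulo `X ^ (N + 1)`. -/
noncomputable def truncatedMul (N : ℕ) (R : ℂ[X]) :
    EuclideanSpace ℂ (Fin (N + 1)) →L[ℂ] EuclideanSpace ℂ (Fin (N + 1)) :=
  LinearMap.toContinuousLinearMap
    { toFun := fun x => coeffVec N (R * polyOfCoeffs N x)
      map_add' := fun x y => by
        have : polyOfCoeffs N (x + y) = polyOfCoeffs N x + polyOfCoeffs N y := by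
          simp [polyOfCoeffs, Finset.sum_add_distrib]
        rw [this]
        ext i
        simp [coeffVec, mul_add]
      map_smul' := fun c x => by
        have : polyOfCoeffs N (c • x) = c • polyOfCoeffs N x := by
          simp [polyOfCoeffs, Finset.smul_sum, smul_monomial]
        rw [this]
        ext i
        simp [coeffVec] }

theorem truncatedMul_coeffVec {N : ℕ} {R w y : ℂ[X]} (h : X ^ (N + 1) ∣ R * w - y) :
    truncatedMul N R (coeffVec N w) = coeffVec N y := by
  change coeffVec N (R * polyOfCoeffs N (coeffVec N w)) = coeffVec N y
  rw [coeffVec_eq_iff]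
  have h1 := coeffVec_eq_iff.1 (coeffVec_polyOfCoeffs N (coeffVec N w))
  have h2 := (h1.mul_left R).add h
  convert h2 using 1
  ring

/-- Here s is the operator norm and u attains it. The degrees of w and y are free because only their
first N + 1 coefficients enter. -/
theorem exists_extremal (N : ℕ) (R : ℂ[X]) : ∃ (s : ℝ) (u v : ℂ[X]), 0 ≤ s ∧ u ≠ 0 ∧
    u.natDegree ≤ N ∧ v.natDegree ≤ N ∧ X ^ (N + 1) ∣ R * u - v ∧
    ∀ w y : ℂ[X], X ^ (N + 1) ∣ R * w - y → coeffInner N v y = (s : ℂ) ^ 2 * coeffInner N u w ∧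
      (coeffInner N y y).re ≤ s ^ 2 * (coeffInner N w w).re := by
  obtain ⟨x, hx, hxy⟩ := (truncatedMul N R).exists_inner_map_eq_norm_sq_mul
  have hv : coeffVec N (polyOfCoeffs N (truncatedMul N R x)) = truncatedMul N R x :=
    coeffVec_polyOfCoeffs N _
  refine ⟨‖truncatedMul N R‖, polyOfCoeffs N x, polyOfCoeffs N (truncatedMul N R x),
    norm_nonneg _, fun h => hx ?_, natDegree_polyOfCoeffs_le N _, natDegree_polyOfCoeffs_le N _,
    coeffVec_eq_iff.1 hv.symm, fun w y h => ⟨?_, ?_⟩⟩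
  · rw [← coeffVec_polyOfCoeffs N x, h]
    ext i
    simp [coeffVec]
  · rw [← inner_coeffVec, ← inner_coeffVec, hv, coeffVec_polyOfCoeffs, ← hxy,
      truncatedMul_coeffVec h]
  · rw [← norm_coeffVec_sq, ← norm_coeffVec_sq, ← mul_pow, ← truncatedMul_coeffVec h]
    exact pow_le_pow_left₀ (norm_nonneg _) ((truncatedMul N R).le_opNorm _) 2

end extremal

/-! ### Carathéodory–Fejér by dividing out zeros -/

section descent

open scoped ComplexConjugate

/-- `u` is a polynomial on which multiplication by `R` modulo `X ^ (N + 1)` acts, on the unit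
circle, by scaling the absolute value by `s`; its image is `v`. -/
structure IsUnimodularPair (N : ℕ) (R : ℂ[X]) (s : ℝ) (u v : ℂ[X]) : Prop where
  ne_zero : u ≠ 0
  natDegree_left : u.natDegree ≤ N
  natDegree_right : v.natDegree ≤ N
  dvd : X ^ (N + 1) ∣ R * u - v
  eq : conjReflect N v * v = C ((s : ℂ) ^ 2) * (conjReflect N u * u)

theorem coeffInner_self_re (N : ℕ) (p : ℂ[X]) :
    coeffInner N p p = ((coeffInner N p p).re : ℂ) := by
  rw [← norm_coeffVec_sq, ← inner_coeffVec, inner_self_eq_norm_sq_to_K]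
  norm_cast

/-- Testing the extremal identity on the shifts X^j u and X^j v compares the autocorrelations of u
and v, which are the coefficients of the two products up to degree N. -/
theorem IsUnimodularPair.of_coeffInner {N : ℕ} {R u v : ℂ[X]} {s : ℝ} (hu0 : u ≠ 0)
    (hu : u.natDegree ≤ N) (hv : v.natDegree ≤ N) (h : X ^ (N + 1) ∣ R * u - v)
    (H : ∀ w y : ℂ[X], X ^ (N + 1) ∣ R * w - y →
      coeffInner N v y = (s : ℂ) ^ 2 * coeffInner N u w) : IsUnimodularPair N R s u v := by
  refine ⟨hu0, hu, hv, h, ?_⟩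
  have low : ∀ k ≤ N, (conjReflect N v * v).coeff k
      = (C ((s : ℂ) ^ 2) * (conjReflect N u * u)).coeff k := by
    intro k hk
    have h1 := H (X ^ (N - k) * u) (X ^ (N - k) * v) (by
      convert h.mul_left (X ^ (N - k)) using 1; ring)
    rw [← coeff_conjReflect_mul_sub (Nat.sub_le _ _), ← coeff_conjReflect_mul_sub (Nat.sub_le _ _),
      Nat.sub_sub_self hk] at h1
    rw [coeff_C_mul, h1]
  ext k
  rcases le_or_gt k N with hk | hk
  · exact low k hk
  rcases le_or_gt k (2 * N) with hk2 | hk2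
  -- Both products are fixed by conjugate reversal in degree 2N, so the lower half determines the
  -- upper half.
  · have h2 := low (2 * N - k) (by omega)
    rw [coeff_C_mul] at h2 ⊢
    rw [coeff_conjReflect_mul_self_symm hv hk2, coeff_conjReflect_mul_self_symm hu hk2, h2,
      map_mul, map_pow, Complex.conj_ofReal]
  · have deg : ∀ p : ℂ[X], p.natDegree ≤ N → (conjReflect N p * p).coeff k = 0 := fun p hp =>
      coeff_eq_zero_of_natDegree_lt ((natDegree_mul_le_of_le (natDegree_conjReflect_le hp) hp
        |>.trans_eq (two_mul N).symm).trans_lt hk2)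
    rw [coeff_C_mul, deg v hv, deg u hu, mul_zero]

theorem IsUnimodularPair.norm_eval {N : ℕ} {R u v : ℂ[X]} {s : ℝ} (h : IsUnimodularPair N R s u v)
    (hs : 0 ≤ s) {z : ℂ} (hz : ‖z‖ = 1) : ‖v.eval z‖ = s * ‖u.eval z‖ := by
  have h1 := congrArg (fun p => ‖p.eval z‖) h.eq
  simp only [eval_mul, eval_C, eval_conjReflect h.natDegree_left hz,
    eval_conjReflect h.natDegree_right hz, norm_mul, norm_pow, hz, one_pow, one_mul,
    Complex.norm_real, RCLike.norm_conj, Real.norm_eq_abs, sq_abs] at h1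
  rw [← abs_of_nonneg (norm_nonneg (v.eval z)), ← abs_of_nonneg (mul_nonneg hs (norm_nonneg _)),
    ← sq_eq_sq_iff_abs_eq_abs]
  linear_combination h1

theorem eq_C_mul_X_pow_of_dvd {m : ℕ} {q : ℂ[X]} (h : X ^ m ∣ q) (hq : q.natDegree ≤ m) :
    q = C (q.coeff m) * X ^ m := by
  ext k
  rw [coeff_C_mul_X_pow]
  split_ifs with hk
  · rw [hk]
  · rcases lt_or_gt_of_ne hk with hk | hk
    · exact X_pow_dvd_iff.1 h k hk
    · exact coeff_eq_zero_of_natDegree_lt (hq.trans_lt hk)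

/-- Multiplication by the geometric series of 1/(1 - aX). -/
theorem coeff_of_one_sub_C_mul_X_mul {N : ℕ} {D E : ℂ[X]} {a : ℂ}
    (h : ∀ k ≤ N, ((1 - C a * X) * D).coeff k = E.coeff k) :
    ∀ k ≤ N, D.coeff k = ∑ i ∈ Finset.range (k + 1), a ^ (k - i) * E.coeff i := by
  have hc : ∀ k, ((1 - C a * X) * D).coeff (k + 1) = D.coeff (k + 1) - a * D.coeff k := by
    intro k
    rw [sub_mul, one_mul, coeff_sub, mul_assoc, coeff_C_mul, coeff_X_mul]
  intro k
  induction k with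
  | zero =>
    intro _
    have := h 0 (Nat.zero_le _)
    simpa [sub_mul, mul_assoc] using this
  | succ k ih =>
    intro hk
    have h1 := h (k + 1) hk
    rw [hc, ih (by omega), Finset.mul_sum] at h1
    rw [Finset.sum_range_succ, Nat.sub_self, pow_zero, one_mul, ← h1,
      ← add_sub_assoc, eq_sub_iff_add_eq', add_left_inj]
    refine Finset.sum_congr rfl fun i hi => ?_
    have : k + 1 - i = (k - i) + 1 := by
      have := Finset.mem_range.1 hi
      omega
    rw [this, pow_succ]
    ring

/-- Reflecting the zero a replaces u by a polynomial of the same norm, so extremality gives ‖r‖ ≤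
‖v‖. The two sides can differ only by c X^(N+1), and |c|² = (1 - |a|²)(‖r‖² - ‖v‖²) ≤ 0. -/
theorem IsUnimodularPair.sub_mul_eq {N : ℕ} {R u₁ v r : ℂ[X]} {s : ℝ} {a : ℂ}
    (ha : ‖a‖ ≤ 1) (h : IsUnimodularPair N R s ((X - C a) * u₁) v) (hr : r.natDegree ≤ N)
    (hdvd : X ^ (N + 1) ∣ R * ((1 - C (conj a) * X) * u₁) - r)
    (H : (coeffInner N r r).re ≤ s ^ 2 *
      (coeffInner N ((1 - C (conj a) * X) * u₁) ((1 - C (conj a) * X) * u₁)).re) :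
    (X - C a) * r = (1 - C (conj a) * X) * v := by
  have hu₁ : u₁ ≠ 0 := right_ne_zero_of_mul h.ne_zero
  obtain ⟨M, rfl⟩ : ∃ M, N = M + 1 := by
    have := h.natDegree_left
    rw [natDegree_mul (X_sub_C_ne_zero a) hu₁, natDegree_X_sub_C] at this
    exact ⟨N - 1, by omega⟩
  have hM : u₁.natDegree ≤ M := by
    have := h.natDegree_left
    rw [natDegree_mul (X_sub_C_ne_zero a) hu₁, natDegree_X_sub_C] at this
    omega
  set N := M + 1 with hN
  have hv := h.natDegree_right
  have hu' : conjReflect N ((1 - C (conj a) * X) * u₁) * ((1 - C (conj a) * X) * u₁)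
      = conjReflect N ((X - C a) * u₁) * ((X - C a) * u₁) := by
    rw [conjReflect_X_sub_C_mul a hM, conjReflect_one_sub_C_mul_X_mul a hM]
    ring
  have hle : (coeffInner N r r).re ≤ (coeffInner N v v).re := by
    rw [← coeff_conjReflect_mul_self (p := (1 - C (conj a) * X) * u₁), hu',
      coeff_conjReflect_mul_self] at H
    refine H.trans_eq ?_
    rw [← coeff_conjReflect_mul_self (p := v), h.eq, coeff_C_mul, coeff_conjReflect_mul_self,
      ← Complex.ofReal_pow, Complex.re_ofReal_mul]
  set c := ((X - C a) * r - (1 - C (conj a) * X) * v).coeff (N + 1) with hc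
  have hcX : (X - C a) * r - (1 - C (conj a) * X) * v = C c * X ^ (N + 1) := by
    refine eq_C_mul_X_pow_of_dvd ?_ ?_
    · convert (h.dvd.mul_left (1 - C (conj a) * X)).sub (hdvd.mul_left (X - C a)) using 1
      ring
    · refine (natDegree_sub_le_of_le (n := N + 1) (m := N + 1) ?_ ?_).trans (max_self _).le
      · exact (natDegree_mul_le_of_le (natDegree_X_sub_C_le a) hr).trans_eq (add_comm _ _)
      · exact (natDegree_mul_le_of_le (natDegree_one_sub_C_mul_X_le _) hv).trans_eq (add_comm _ _)
  suffices hc0 : c = 0 by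
    rw [hc0, C_0, zero_mul] at hcX
    exact sub_eq_zero.1 hcX
  have hrefl : (1 - C (conj a) * X) * conjReflect N r - (X - C a) * conjReflect N v
      = C (conj c) := by
    rw [← conjReflect_X_sub_C_mul a hr, ← conjReflect_one_sub_C_mul_X_mul a hv, ← conjReflect_sub,
      hcX, conjReflect_C_mul_X_pow]
  have hra : (1 - (‖a‖ : ℂ) ^ 2) * (conjReflect N r).eval a = conj c := by
    have := congrArg (eval a) hrefl
    simp only [eval_sub, eval_mul, eval_one, eval_C, eval_X, sub_self, zero_mul, sub_zero] at this
    rw [← this, Complex.conj_mul']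
  -- The coefficient of degree N in the difference is ‖r‖² - ‖v‖²; the term in X^(N+1) does not
  -- reach it.
  have hD : (1 - C (conj a) * X) * (conjReflect N r * r - conjReflect N v * v)
      = C (conj c) * r + C c * conjReflect N v * X ^ (N + 1) := by
    apply mul_left_cancel₀ (X_sub_C_ne_zero a)
    linear_combination (X - C a) * r * hrefl + (X - C a) * conjReflect N v * hcX
  have hDN : (conjReflect N r * r - conjReflect N v * v).coeff N
      = conj c * conj ((conjReflect N r).eval a) := by
    rw [coeff_of_one_sub_C_mul_X_mul (E := C (conj c) * r) (N := N) (fun k hk => by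
        rw [hD, coeff_add, coeff_mul_X_pow', if_neg (by omega), add_zero]) N le_rfl,
      eval_eq_sum_range' (Nat.lt_succ_of_le (natDegree_conjReflect_le hr)), map_sum,
      Finset.mul_sum, ← Finset.sum_range_reflect]
    refine Finset.sum_congr rfl fun i hi => ?_
    have hi' : i ≤ N := Nat.lt_succ_iff.1 (Finset.mem_range.1 hi)
    rw [Nat.succ_sub_one, Nat.sub_sub_self hi', coeff_conjReflect hi', map_mul, map_pow,
      Complex.conj_conj, coeff_C_mul]
    ring
  rw [coeff_sub, coeff_conjReflect_mul_self, coeff_conjReflect_mul_self, coeffInner_self_re,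
    coeffInner_self_re N v] at hDN
  have h1 : (‖c‖ : ℂ) ^ 2 = (1 - (‖a‖ : ℂ) ^ 2) *
      ((coeffInner N r r).re - (coeffInner N v v).re) := by
    rw [hDN, ← Complex.conj_mul']
    have := congrArg conj hra
    simp only [map_mul, map_sub, map_one, map_pow, Complex.conj_ofReal, Complex.conj_conj] at this
    linear_combination -conj c * this
  have h2 : ‖c‖ ^ 2 = (1 - ‖a‖ ^ 2) * ((coeffInner N r r).re - (coeffInner N v v).re) := by
    exact_mod_cast h1
  have h3 : ‖c‖ ^ 2 ≤ 0 := by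
    rw [h2]
    exact mul_nonpos_of_nonneg_of_nonpos (by nlinarith [norm_nonneg a]) (by linarith)
  exact norm_eq_zero.1 (sq_eq_zero_iff.1 (le_antisymm h3 (sq_nonneg _)))

theorem one_sub_C_mul_X_ne_zero (a : ℂ) : (1 - C a * X : ℂ[X]) ≠ 0 := fun h => by
  simpa using congrArg (eval 0) h

/-- A zero of `u` in the closed unit disc can be divided out of a unimodular pair. -/
theorem IsUnimodularPair.exists_of_isRoot {N : ℕ} {R u v : ℂ[X]} {s : ℝ} (hs : 0 ≤ s)
    (H : ∀ w y : ℂ[X], X ^ (N + 1) ∣ R * w - y →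
      (coeffInner N y y).re ≤ s ^ 2 * (coeffInner N w w).re)
    (h : IsUnimodularPair N R s u v) {a : ℂ} (ha : ‖a‖ ≤ 1) (hu : u.IsRoot a) :
    ∃ u₁ v₁, IsUnimodularPair N R s u₁ v₁ ∧ u₁.natDegree < u.natDegree := by
  obtain ⟨u₁, rfl⟩ := dvd_iff_isRoot.2 hu
  have hu₁ : u₁ ≠ 0 := right_ne_zero_of_mul h.ne_zero
  have hdeg : ((X - C a) * u₁).natDegree = u₁.natDegree + 1 := by
    rw [natDegree_mul (X_sub_C_ne_zero a) hu₁, natDegree_X_sub_C, add_comm]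
  have hpm : (X ^ (N + 1) : ℂ[X]).Monic := monic_X_pow _
  set w := (1 - C (conj a) * X) * u₁ with hw
  set r := (R * w) %ₘ X ^ (N + 1) with hr
  have hrN : r.natDegree ≤ N := by
    have := natDegree_modByMonic_lt (R * w) hpm (by
      intro h
      have := congrArg natDegree h
      simp at this)
    rw [natDegree_X_pow, ← hr] at this
    omega
  have hrd : X ^ (N + 1) ∣ R * w - r :=
    ⟨(R * w) /ₘ X ^ (N + 1), sub_eq_iff_eq_add'.2 (modByMonic_add_div _ _).symm⟩
  have hrv := h.sub_mul_eq ha hrN hrd (H _ _ hrd)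
  -- Inside the disc 1 - |a|² ≠ 0 lets `hrv` decide; on the circle that factor vanishes, and |v| =
  -- s|u| is used instead.
  have hva : v.IsRoot a := by
    rcases ha.lt_or_eq with ha | ha
    · have h1 := congrArg (eval a) hrv
      simp only [eval_sub, eval_mul, eval_one, eval_C, eval_X, sub_self, zero_mul] at h1
      rw [Complex.conj_mul'] at h1
      refine (mul_eq_zero.1 h1.symm).resolve_left fun h2 => ?_
      have h3 : 1 - ‖a‖ ^ 2 = 0 := by exact_mod_cast h2
      nlinarith [norm_nonneg a]
    · have h1 := h.norm_eval hs ha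
      rw [hu.eq_zero, norm_zero, mul_zero] at h1
      exact norm_eq_zero.1 h1
  obtain ⟨v₁, rfl⟩ := dvd_iff_isRoot.2 hva
  have hrv₁ : r = (1 - C (conj a) * X) * v₁ := by
    apply mul_left_cancel₀ (X_sub_C_ne_zero a)
    rw [hrv]
    ring
  obtain ⟨M, rfl⟩ : ∃ M, N = M + 1 := by
    have := h.natDegree_left
    exact ⟨N - 1, by omega⟩
  have hM : u₁.natDegree ≤ M := by
    have := h.natDegree_left
    omega
  have hMv : v₁.natDegree ≤ M := by
    rcases eq_or_ne v₁ 0 with rfl | hv₁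
    · simp
    · have := h.natDegree_right
      rw [natDegree_mul (X_sub_C_ne_zero a) hv₁, natDegree_X_sub_C] at this
      omega
  refine ⟨u₁, v₁, ⟨hu₁, by omega, by omega, ?_, ?_⟩, by omega⟩
  -- R w - r is (1 - conj(a) X)(R u₁ - v₁), and its first factor is a unit modulo powers of X.
  · have hco : IsCoprime (X ^ (M + 1 + 1) : ℂ[X]) (1 - C (conj a) * X) :=
      IsCoprime.pow_left ⟨C (conj a), 1, by ring⟩
    refine hco.dvd_of_dvd_mul_left (z := R * u₁ - v₁) ?_
    convert hrd using 1
    rw [hrv₁, hw]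
    ring
  · have h1 := h.eq
    rw [conjReflect_X_sub_C_mul a hM, conjReflect_X_sub_C_mul a hMv] at h1
    rw [conjReflect_succ hM, conjReflect_succ hMv]
    have h2 : conjReflect M v₁ * v₁ = C ((s : ℂ) ^ 2) * (conjReflect M u₁ * u₁) := by
      apply mul_left_cancel₀ (mul_ne_zero (one_sub_C_mul_X_ne_zero (conj a)) (X_sub_C_ne_zero a))
      linear_combination h1
    linear_combination X * h2

/-- The Carathéodory–Fejér theorem. -/
theorem exists_unimodular_interpolant (N : ℕ) (R : ℂ[X]) : ∃ (s : ℝ) (u v r : ℂ[X]), 0 ≤ s ∧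
    v.natDegree ≤ N ∧ R * u = v + X ^ (N + 1) * r ∧ (∀ z : ℂ, ‖z‖ ≤ 1 → u.eval z ≠ 0) ∧
    ∀ z : ℂ, ‖z‖ = 1 → ‖v.eval z‖ = s * ‖u.eval z‖ := by
  obtain ⟨s, u₀, v₀, hs, hu0, hu, hv, hd, H⟩ := exists_extremal N R
  have h₀ := IsUnimodularPair.of_coeffInner hu0 hu hv hd fun w y h => (H w y h).1
  obtain ⟨⟨u, v⟩, h, hmin⟩ := exists_minimalFor_of_wellFoundedLT
    (fun p : ℂ[X] × ℂ[X] => IsUnimodularPair N R s p.1 p.2) (fun p => p.1.natDegree) ⟨(u₀, v₀), h₀⟩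
  obtain ⟨r, hr⟩ := h.dvd
  refine ⟨s, u, v, r, hs, h.natDegree_right, sub_eq_iff_eq_add'.1 hr, fun a ha hroot => ?_,
    fun z hz => h.norm_eval hs hz⟩
  obtain ⟨u₁, v₁, h₁, hlt⟩ := h.exists_of_isRoot hs (fun w y h => (H w y h).2) ha hroot
  exact absurd (hmin (j := (u₁, v₁)) h₁ hlt.le) (not_le.2 hlt)

end descent

/-! ### Polynomial approximation on the disc and on the circle -/

/-- The reciprocal of a polynomial without zeros in the closed unit disc is a uniform limit of
polynomials there. -/
theorem exists_mul_eval_sub_one_lt {w : ℂ[X]} (hw : ∀ z : ℂ, ‖z‖ ≤ 1 → w.eval z ≠ 0) {η : ℝ}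
    (hη : 0 < η) : ∃ Q : ℂ[X], ∀ z : ℂ, ‖z‖ ≤ 1 → ‖w.eval z * Q.eval z - 1‖ < η := by
  -- By compactness w stays zero-free on a disc of radius 1 + δ, so the Taylor series of 1/w
  -- converges uniformly on radius 1 + δ/2.
  have hopen : IsOpen {z : ℂ | w.eval z ≠ 0} := isOpen_ne_fun w.continuous continuous_const
  obtain ⟨δ, hδ, hsub⟩ := (isCompact_closedBall (0 : ℂ) 1).exists_cthickening_subset_open hopen
    fun z hz => hw z (by simpa using hz)
  rw [cthickening_closedBall hδ.le zero_le_one] at hsub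
  lift δ to NNReal using hδ.le
  have hδ' : 0 < δ := by exact_mod_cast hδ
  have hps : HasFPowerSeriesOnBall (fun z => (w.eval z)⁻¹) _ 0 ((δ + 1 : NNReal) : ENNReal) :=
    DifferentiableOn.hasFPowerSeriesOnBall (R := δ + 1) (c := 0)
      (w.differentiable.differentiableOn.inv fun z hz => hsub (by
        simpa [add_comm] using hz)) (by positivity)
  have htend := hps.tendstoUniformlyOn (r' := δ / 2 + 1) (by
    have : δ / 2 < δ := NNReal.half_lt_self hδ'.ne'
    exact_mod_cast add_lt_add_left this 1)
  obtain ⟨B, hB⟩ := (isCompact_closedBall (0 : ℂ) 1).exists_bound_of_continuousOn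
    w.continuous.continuousOn
  have hB' : 0 < |B| + 1 := by positivity
  obtain ⟨n, hn⟩ := (Metric.tendstoUniformlyOn_iff.1 htend (η / (|B| + 1)) (by positivity)).exists
  obtain ⟨Q, hQ⟩ : ∃ Q : ℂ[X], ∀ z, Q.eval z
      = (cauchyPowerSeries (fun z => (w.eval z)⁻¹) 0 (δ + 1 : NNReal)).partialSum n z := by
    refine ⟨∑ k ∈ Finset.range n, monomial k ((cauchyPowerSeries (fun z => (w.eval z)⁻¹) 0
      (δ + 1 : NNReal)).coeff k), fun z => ?_⟩
    simp [FormalMultilinearSeries.partialSum, eval_finsetSum, mul_comm]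
  refine ⟨Q, fun z hz => ?_⟩
  have h1 := hn z (by
    rw [mem_ball_zero_iff]
    refine hz.trans_lt ?_
    push_cast
    linarith)
  rw [zero_add, dist_comm, dist_eq_norm, ← hQ] at h1
  have h2 : w.eval z * Q.eval z - 1 = w.eval z * (Q.eval z - (w.eval z)⁻¹) := by
    rw [mul_sub, mul_inv_cancel₀ (hw z hz)]
  have h3 : ‖w.eval z‖ ≤ |B| := (hB z (by simpa using hz)).trans (le_abs_self B)
  rw [h2, norm_mul]
  calc ‖w.eval z‖ * ‖Q.eval z - (w.eval z)⁻¹‖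
      ≤ |B| * ‖Q.eval z - (w.eval z)⁻¹‖ := by gcongr
    _ ≤ (|B| + 1) * ‖Q.eval z - (w.eval z)⁻¹‖ := by gcongr; linarith
    _ < (|B| + 1) * (η / (|B| + 1)) := by gcongr
    _ = η := mul_div_cancel₀ _ hB'.ne'

theorem exists_mul_eval_sub_eval_lt {w : ℂ[X]} (hw : ∀ z : ℂ, ‖z‖ ≤ 1 → w.eval z ≠ 0)
    (u : ℂ[X]) {η : ℝ} (hη : 0 < η) :
    ∃ Q : ℂ[X], ∀ z : ℂ, ‖z‖ ≤ 1 → ‖w.eval z * Q.eval z - u.eval z‖ < η := by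
  obtain ⟨B, hB⟩ := (isCompact_closedBall (0 : ℂ) 1).exists_bound_of_continuousOn
    u.continuous.continuousOn
  have hB' : 0 < |B| + 1 := by positivity
  obtain ⟨Q, hQ⟩ := exists_mul_eval_sub_one_lt hw (η := η / (|B| + 1)) (by positivity)
  refine ⟨u * Q, fun z hz => ?_⟩
  have h3 : ‖u.eval z‖ ≤ |B| := (hB z (by simpa using hz)).trans (le_abs_self B)
  have h2 : w.eval z * (u * Q).eval z - u.eval z
      = u.eval z * (w.eval z * Q.eval z - 1) := by
    rw [eval_mul]; ring
  rw [h2, norm_mul]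
  calc ‖u.eval z‖ * ‖w.eval z * Q.eval z - 1‖
      ≤ |B| * ‖w.eval z * Q.eval z - 1‖ := by gcongr
    _ ≤ (|B| + 1) * ‖w.eval z * Q.eval z - 1‖ := by gcongr; linarith
    _ < (|B| + 1) * (η / (|B| + 1)) := by gcongr; exact hQ z hz
    _ = η := mul_div_cancel₀ _ hB'.ne'

theorem Circle.exists_polynomial_approx {f : Circle → ℂ} (hf : Continuous f) {ε : ℝ} (hε : 0 < ε) :
    ∃ (n : ℕ) (R : ℂ[X]), ∀ z : Circle, ‖(z : ℂ) ^ n * f z - R.eval (z : ℂ)‖ < ε := by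
  -- Stone–Weierstrass reduces to polynomials in z and conj z. Asking for all large n lets sums
  -- share an exponent.
  have key : ∀ g ∈ (polynomialFunctions (Metric.sphere (0 : ℂ) 1)).starClosure,
      ∃ n₀ : ℕ, ∀ n ≥ n₀, ∃ R : ℂ[X], ∀ z : Metric.sphere (0 : ℂ) 1,
        (z : ℂ) ^ n * g z = R.eval (z : ℂ) := by
    intro g hg
    rw [polynomialFunctions.starClosure_eq_adjoin_X] at hg
    induction hg using StarAlgebra.adjoin_induction with
    | mem x hx =>
      obtain rfl := Set.mem_singleton_iff.1 hx
      exact ⟨0, fun n _ => ⟨X ^ n * X, fun z => by simp⟩⟩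
    | algebraMap c => exact ⟨0, fun n _ => ⟨C c * X ^ n, fun z => by simp [mul_comm (_ ^ n)]⟩⟩
    | add x y _ _ hx hy =>
      obtain ⟨m, hm⟩ := hx
      obtain ⟨k, hk⟩ := hy
      refine ⟨max m k, fun n hn => ?_⟩
      obtain ⟨P, hP⟩ := hm n (le_of_max_le_left hn)
      obtain ⟨Q, hQ⟩ := hk n (le_of_max_le_right hn)
      exact ⟨P + Q, fun z => by
        rw [eval_add, ← hP, ← hQ, ContinuousMap.add_apply, mul_add]⟩
    | mul x y _ _ hx hy =>
      obtain ⟨m, hm⟩ := hx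
      obtain ⟨k, hk⟩ := hy
      refine ⟨m + k, fun n hn => ?_⟩
      obtain ⟨P, hP⟩ := hm m le_rfl
      obtain ⟨Q, hQ⟩ := hk (n - m) (by omega)
      refine ⟨P * Q, fun z => ?_⟩
      rw [eval_mul, ← hP, ← hQ, ContinuousMap.mul_apply, ← Nat.add_sub_of_le (show m ≤ n by omega),
        pow_add, Nat.add_sub_cancel_left]
      ring
    | star x _ hx =>
      obtain ⟨m, hm⟩ := hx
      obtain ⟨P, hP⟩ := hm m le_rfl
      refine ⟨P.natDegree + m, fun n hn => ⟨X ^ (n - P.natDegree + m) * conjReflect P.natDegree P,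
        fun z => ?_⟩⟩
      have hz : ‖(z : ℂ)‖ = 1 := by simp
      have hz1 : (z : ℂ) * (starRingEnd ℂ) z = 1 := by
        rw [Complex.mul_conj, Complex.normSq_eq_norm_sq, hz]; norm_num
      have h2 : ((z : ℂ) ^ m) * (starRingEnd ℂ) z ^ m = 1 := by rw [← mul_pow, hz1, one_pow]
      rw [eval_mul, eval_conjReflect le_rfl hz, ← hP, map_mul, map_pow, ContinuousMap.star_apply,
        eval_pow, eval_X]
      have h3 : (z : ℂ) ^ n = (z : ℂ) ^ (n - P.natDegree) * (z : ℂ) ^ P.natDegree := by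
        rw [← pow_add, Nat.sub_add_cancel (by omega)]
      rw [h3, pow_add]
      change _ * (starRingEnd ℂ) (x z) = _
      linear_combination (-(z : ℂ) ^ (n - P.natDegree) * (z : ℂ) ^ P.natDegree
        * (starRingEnd ℂ) (x z)) * h2
  let F : C(Metric.sphere (0 : ℂ) 1, ℂ) :=
    ⟨fun z => f ⟨z, z.2⟩, hf.comp (by fun_prop)⟩
  have hF : F ∈ (polynomialFunctions (Metric.sphere (0 : ℂ) 1)).starClosure.topologicalClosure := by
    rw [polynomialFunctions.starClosure_topologicalClosure]
    trivial
  obtain ⟨g, hg, hFg⟩ := Metric.mem_closure_iff.1 hF ε hε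
  obtain ⟨n, hn⟩ := key g hg
  obtain ⟨R, hR⟩ := hn n le_rfl
  refine ⟨n, R, fun z => ?_⟩
  have h1 := hR ⟨z, z.2⟩
  have h2 := (ContinuousMap.dist_apply_le_dist (f := F) (g := g) ⟨z, z.2⟩).trans_lt hFg
  change (z : ℂ) ^ n * g _ = R.eval (z : ℂ) at h1
  rw [dist_eq_norm] at h2
  rw [← h1, ← mul_sub, norm_mul, norm_pow, Circle.norm_coe, one_pow, one_mul]
  exact h2

/-- Uniform limits of polynomials on the circle extend holomorphically. -/
theorem extendsHolomorphically_of_approx {f : Circle → ℂ}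
    (h : ∀ ε > 0, ∃ Q : ℂ[X], ∀ z : Circle, ‖f z - Q.eval (z : ℂ)‖ ≤ ε) :
    ExtendsHolomorphically f := by
  choose Q hQ using fun k : ℕ => h (1 / (k + 1)) (by positivity)
  -- The maximum principle carries the Cauchy estimate from the circle to the disc.
  have hdiff : ∀ j k : ℕ, ∀ z ∈ Metric.closedBall (0 : ℂ) 1,
      ‖(Q j).eval z - (Q k).eval z‖ ≤ 1 / ((j : ℝ) + 1) + 1 / ((k : ℝ) + 1) := by
    intro j k z hz
    rw [← closure_ball (0 : ℂ) one_ne_zero] at hz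
    refine Complex.norm_le_of_forall_mem_frontier_norm_le (f := fun z => (Q j).eval z - (Q k).eval z)
      Metric.isBounded_ball
      ((Q j).differentiable.sub (Q k).differentiable).diffContOnCl (fun w hw => ?_) hz
    rw [frontier_ball (0 : ℂ) one_ne_zero] at hw
    have h1 := hQ j ⟨w, hw⟩
    have h2 := hQ k ⟨w, hw⟩
    calc ‖(Q j).eval w - (Q k).eval w‖
        = ‖(f ⟨w, hw⟩ - (Q k).eval w) - (f ⟨w, hw⟩ - (Q j).eval w)‖ := by congr 1; ring
      _ ≤ _ := (norm_sub_le _ _).trans (by rw [add_comm]; exact add_le_add h1 h2)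
  have hcauchy : UniformCauchySeqOn (fun k z => (Q k).eval z) Filter.atTop
      (Metric.closedBall (0 : ℂ) 1) := by
    rw [Metric.uniformCauchySeqOn_iff]
    intro ε hε
    obtain ⟨n, hn⟩ := exists_nat_one_div_lt (half_pos hε)
    refine ⟨n, fun j hj k hk z hz => ?_⟩
    rw [dist_eq_norm]
    have h1 : 1 / ((j : ℝ) + 1) ≤ 1 / ((n : ℝ) + 1) := Nat.one_div_le_one_div hj
    have h2 : 1 / ((k : ℝ) + 1) ≤ 1 / ((n : ℝ) + 1) := Nat.one_div_le_one_div hk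
    linarith [hdiff j k z hz]
  have hlim : ∀ z : ℂ, ∃ l : ℂ, z ∈ Metric.closedBall (0 : ℂ) 1 →
      Filter.Tendsto (fun k => (Q k).eval z) Filter.atTop (nhds l) := by
    intro z
    by_cases hz : z ∈ Metric.closedBall (0 : ℂ) 1
    · obtain ⟨l, hl⟩ := cauchySeq_tendsto_of_complete (hcauchy.cauchySeq hz)
      exact ⟨l, fun _ => hl⟩
    · exact ⟨0, fun h => absurd h hz⟩
  choose F hF using hlim
  have hunif := hcauchy.tendstoUniformlyOn_of_tendsto hF
  refine ⟨F, hunif.continuousOn (Filter.Eventually.of_forall fun k =>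
    (Q k).continuous.continuousOn).frequently, ?_, fun z => ?_⟩
  · exact (hunif.mono Metric.ball_subset_closedBall).tendstoLocallyUniformlyOn.differentiableOn
      (Filter.Eventually.of_forall fun k => (Q k).differentiable.differentiableOn)
      Metric.isOpen_ball
  · refine tendsto_nhds_unique (hF z (mem_closedBall_zero_iff.2 z.norm_coe.le)) ?_
    rw [tendsto_iff_norm_sub_tendsto_zero]
    refine squeeze_zero (fun _ => norm_nonneg _) (fun k => ?_)
      (tendsto_one_div_add_atTop_nhds_zero_nat (𝕜 := ℝ))
    rw [norm_sub_rev]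
    exact hQ k z

/-! ### Negative winding and the conclusion -/

/-- If `z ^ n * f` is close to `R` in comparison with the constant `s` of the Carathéodory–Fejér
interpolant, then some `P * (f + c) + 1` has negative winding number. -/
theorem exists_windingNumber_neg {f : Circle → ℂ} (hf : Continuous f) {N : ℕ} {R u v r : ℂ[X]}
    {s ε : ℝ} (hfR : ∀ z : Circle, ‖(z : ℂ) ^ (N + 1) * f z - R.eval (z : ℂ)‖ < ε) (hεs : ε < s)
    (hv : v.natDegree ≤ N) (hR : R * u = v + X ^ (N + 1) * r)
    (hu : ∀ z : ℂ, ‖z‖ ≤ 1 → u.eval z ≠ 0)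
    (huv : ∀ z : ℂ, ‖z‖ = 1 → ‖v.eval z‖ = s * ‖u.eval z‖) :
    ∃ (c : ℂ) (P : ℂ[X]), (∀ z : Circle, P.eval (z : ℂ) * (f z + c) + 1 ≠ 0) ∧
      windingNumber (fun z : Circle => P.eval (z : ℂ) * (f z + c) + 1) < 0 := by
  have hε : 0 < ε := (norm_nonneg _).trans_lt (hfR 1)
  obtain ⟨B, hB⟩ := (isCompact_closedBall (0 : ℂ) 1).exists_bound_of_continuousOn
    (f := fun z => r.eval z / u.eval z)
    (r.continuous.continuousOn.div u.continuous.continuousOn fun z hz => hu z (by simpa using hz))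
  -- Larger than |r/u| on the closed disc, so r/u + c has no zeros there.
  set c : ℂ := ((|B| + 1 : ℝ) : ℂ) with hc
  have hw : ∀ z : ℂ, ‖z‖ ≤ 1 → (r + C c * u).eval z ≠ 0 := by
    intro z hz h
    have h1 : r.eval z / u.eval z = -c := by
      rw [eval_add, eval_mul, eval_C] at h
      rw [div_eq_iff (hu z hz)]
      linear_combination h
    have h2 := hB z (by simpa using hz)
    rw [h1, norm_neg, hc, Complex.norm_real, Real.norm_eq_abs,
      abs_of_nonneg (by positivity)] at h2
    linarith [le_abs_self B]
  obtain ⟨z₀, hz₀m, hz₀⟩ := (isCompact_closedBall (0 : ℂ) 1).exists_isMinOn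
    ⟨0, by simp⟩ u.continuous.norm.continuousOn
  have hz₀u : 0 < ‖u.eval z₀‖ := norm_pos_iff.2 (hu z₀ (by simpa using hz₀m))
  obtain ⟨B', hB'⟩ := isCompact_univ.exists_bound_of_continuousOn (f := fun z : Circle => f z + c)
    (by fun_prop)
  -- The error of P, times |f + c|, must fit in the gap (s - ε)|u| left by the error ε|u| from R.
  set η := (s - ε) * ‖u.eval z₀‖ / (|B'| + 1) with hη
  have hη0 : 0 < η := by
    have := sub_pos.2 hεs
    positivity
  obtain ⟨P, hP⟩ := exists_mul_eval_sub_eval_lt hw (-u) hη0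
  set Φ : Circle → ℂ := fun z => P.eval (z : ℂ) * (f z + c) + 1 with hΦ
  have hΦc : Continuous Φ := by
    have := P.continuous
    fun_prop
  have hsmall : ∀ z : Circle, ‖(z : ℂ) ^ (N + 1) * (r + C c * u).eval (z : ℂ) * Φ z
      - (-v).eval (z : ℂ)‖ < ‖(-v).eval (z : ℂ)‖ := by
    intro z
    have hz : ‖(z : ℂ)‖ = 1 := z.norm_coe
    have h1 := congrArg (eval (z : ℂ)) hR
    simp only [eval_mul, eval_add, eval_pow, eval_X] at h1
    have h2 : (z : ℂ) ^ (N + 1) * (r + C c * u).eval (z : ℂ) * Φ z - (-v).eval (z : ℂ)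
        = (z : ℂ) ^ (N + 1) * (((r + C c * u).eval (z : ℂ) * P.eval (z : ℂ) - (-u).eval (z : ℂ))
          * (f z + c)) - u.eval (z : ℂ) * ((z : ℂ) ^ (N + 1) * f z - R.eval (z : ℂ)) := by
      simp only [hΦ, eval_neg, eval_add, eval_mul, eval_C]
      linear_combination -h1
    have h3 : ‖f z + c‖ < |B'| + 1 :=
      ((hB' z (Set.mem_univ z)).trans (le_abs_self B')).trans_lt (lt_add_one _)
    have h4 : ‖u.eval z₀‖ ≤ ‖u.eval (z : ℂ)‖ := hz₀ (mem_closedBall_zero_iff.2 hz.le)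
    rw [h2, eval_neg v, norm_neg, huv z hz]
    refine (norm_sub_le _ _).trans_lt ?_
    rw [norm_mul, norm_mul, norm_mul, norm_pow, hz, one_pow, one_mul]
    have h5 : ‖(r + C c * u).eval (z : ℂ) * P.eval (z : ℂ) - (-u).eval (z : ℂ)‖ * ‖f z + c‖
        ≤ (s - ε) * ‖u.eval (z : ℂ)‖ := by
      calc _ ≤ η * (|B'| + 1) := by gcongr; exact (hP z hz.le).le
        _ = (s - ε) * ‖u.eval z₀‖ := div_mul_cancel₀ _ (by positivity)
        _ ≤ _ := by
          have := sub_pos.2 hεs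
          gcongr
    have h6 : ‖u.eval (z : ℂ)‖ * ‖(z : ℂ) ^ (N + 1) * f z - R.eval (z : ℂ)‖
        < ‖u.eval (z : ℂ)‖ * ε := by
      have := norm_pos_iff.2 (hu z hz.le)
      gcongr
      exact hfR z
    linarith
  have hvne : ∀ z : Circle, (-v).eval (z : ℂ) ≠ 0 := fun z h => by
    have := hsmall z
    rw [h, norm_zero] at this
    exact absurd this (not_lt.2 (norm_nonneg _))
  have hΦ0 : ∀ z : Circle, Φ z ≠ 0 := fun z h => by
    have := hsmall z
    rw [h, mul_zero, zero_sub, norm_neg] at this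
    exact lt_irrefl _ this
  refine ⟨c, P, hΦ0, ?_⟩
  have hcw : Continuous fun z : Circle => (r + C c * u).eval (z : ℂ) :=
    (r + C c * u).continuous.comp (by fun_prop)
  have hcv : Continuous fun z : Circle => (-v).eval (z : ℂ) := (-v).continuous.comp (by fun_prop)
  have hW1 := ((isWindingNumber_pow (N + 1)).mul (isWindingNumber_eval_zero hw)).mul
    (isWindingNumber_windingNumber hΦc hΦ0)
  have hW2 := (isWindingNumber_eval hvne).of_norm_sub_lt hcv
    (((by fun_prop : Continuous fun z : Circle => (z : ℂ) ^ (N + 1)).mul hcw).mul hΦc) hsmall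
  have hne : ∀ z : Circle, (z : ℂ) ^ (N + 1) * (r + C c * u).eval (z : ℂ) * Φ z ≠ 0 := fun z =>
    mul_ne_zero (mul_ne_zero (pow_ne_zero _ z.coe_ne_zero) (hw z z.norm_coe.le)) (hΦ0 z)
  have hW := hW1.unique hne hW2
  -- At most N zeros against the factor z^(N+1): this difference of one makes the winding number
  -- negative.
  have hcount : (-v).roots.countP (fun a => ‖a‖ < 1) ≤ N :=
    (Multiset.countP_le_card _ _).trans ((card_roots' _).trans ((natDegree_neg v).trans_le hv))
  change windingNumber Φ < 0
  push_cast at hW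
  omega

theorem theorem8p2 (f : Circle → ℂ) (hf : Continuous f)
    (hW : ∀ (c : ℂ) (P : ℂ[X]), (∀ z : Circle, P.eval (z : ℂ) * (f z + c) + 1 ≠ 0) →
      0 ≤ windingNumber (fun z : Circle => P.eval (z : ℂ) * (f z + c) + 1)) :
    ExtendsHolomorphically f := by
  refine extendsHolomorphically_of_approx fun ε hε => ?_
  obtain ⟨N, R₀, hR₀⟩ := Circle.exists_polynomial_approx hf (show 0 < ε / 3 by positivity)
  obtain ⟨R, hfR⟩ : ∃ R : ℂ[X],
      ∀ z : Circle, ‖(z : ℂ) ^ (N + 1) * f z - R.eval (z : ℂ)‖ < ε / 3 := by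
    -- An extra factor z makes the exponent N + 1, one more than the degree bound on v.
    refine ⟨X * R₀, fun z => ?_⟩
    have h1 : (z : ℂ) ^ (N + 1) * f z - (X * R₀).eval (z : ℂ)
        = z * ((z : ℂ) ^ N * f z - R₀.eval (z : ℂ)) := by
      rw [eval_mul, eval_X]; ring
    rw [h1, norm_mul, Circle.norm_coe, one_mul]
    exact hR₀ z
  obtain ⟨s, u, v, r, -, hv, hR, hu, huv⟩ := exists_unimodular_interpolant N R
  rcases lt_or_ge (ε / 3) s with hs | hs
  · obtain ⟨c, P, h0, hneg⟩ := exists_windingNumber_neg hf hfR hs hv hR hu huv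
    exact absurd (hW c P h0) (not_le.2 hneg)
  obtain ⟨z₀, hz₀m, hz₀⟩ := (isCompact_closedBall (0 : ℂ) 1).exists_isMinOn
    ⟨0, by simp⟩ u.continuous.norm.continuousOn
  have hz₀u : 0 < ‖u.eval z₀‖ := norm_pos_iff.2 (hu z₀ (by simpa using hz₀m))
  obtain ⟨Q, hQ⟩ := exists_mul_eval_sub_eval_lt hu r
    (show 0 < ε / 3 * ‖u.eval z₀‖ by positivity)
  refine ⟨Q, fun z => ?_⟩
  have hz : ‖(z : ℂ)‖ = 1 := z.norm_coe
  have hupos : 0 < ‖u.eval (z : ℂ)‖ := norm_pos_iff.2 (hu z hz.le)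
  have h4 : ‖u.eval z₀‖ ≤ ‖u.eval (z : ℂ)‖ := hz₀ (mem_closedBall_zero_iff.2 hz.le)
  have h1 := congrArg (eval (z : ℂ)) hR
  simp only [eval_mul, eval_add, eval_pow, eval_X] at h1
  have h2 : (z : ℂ) ^ (N + 1) * (u.eval (z : ℂ) * (f z - Q.eval (z : ℂ)))
      = u.eval (z : ℂ) * ((z : ℂ) ^ (N + 1) * f z - R.eval (z : ℂ)) + v.eval (z : ℂ)
        - (z : ℂ) ^ (N + 1) * (u.eval (z : ℂ) * Q.eval (z : ℂ) - r.eval (z : ℂ)) := by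
    linear_combination h1
  have h3 := congrArg norm h2
  rw [norm_mul, norm_pow, hz, one_pow, one_mul, norm_mul] at h3
  -- After multiplication by |u|, the errors from R, from v and from Q are each at most (ε/3)|u|.
  refine le_of_mul_le_mul_left ?_ hupos
  rw [h3]
  refine (norm_sub_le _ _).trans ((add_le_add_left (norm_add_le _ _) _).trans ?_)
  rw [norm_mul, norm_mul, norm_pow, hz, one_pow, one_mul, huv z hz]
  have h5 := mul_le_mul_of_nonneg_left (hfR z).le hupos.le
  have h6 := mul_le_mul_of_nonneg_right hs hupos.le
  have h7 := (hQ z hz.le).le.trans (mul_le_mul_of_nonneg_left h4 (by positivity))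
  linarith
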